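/- **Theorem (Deep Maximum Theorem).** Let $\sigma:\mathbb{R}\to\mathbb{R}$ be continuous, and differentiable at some point $x_0$ with $\sigma'(x_0)\neq 0$. Let $K\subseteq\mathbb{R}^m$ be non-empty and compact. Let $C:\mathbb{R}^n\rightrightarrows\mathbb{R}^m$ be a correspondence with closed values such that $C_x\cap K\neq\emptyset$ for every $x\in\mathbb{R}^n$, and which is weakly measurable in the following sense: for every relatively open $U\subseteq K$ the set $\{x\in\mathbb{R}^n: C_x\cap U\neq\emptyset\}$ is Borel. Let $L:\mathbb{R}^n\times\mathbb{R}^m\to\mathbb{R}$ be continuous and let $\mathbb{P}$ be a Borel probability measure on $\mathbb{R}^n$. Then for every $\epsilon\in(0,1]$ there are an integer $N\geq 1$, a feedforward network $\hat f:\mathbb{R}^n\to\mathbb{R}^N$ with activation function $\sigma$ and width at most $n+N+2$, and a matrix $Y\in\mathbb{R}^{N\times m}$ with rows $Y_1,\dots,Y_N$, such that $$\hat F(x)=\sum_{i=1}^N \frac{e^{\hat f(x)_i}}{\sum_{j=1}^N e^{\hat f(x)_j}}\,\delta_{Y_i}\qquad(x\in\mathbb{R}^n)$$ is, for every $x\in\mathbb{R}^n$,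 a Borel probability measure on $\mathbb{R}^m$ with finite mean, and the following hold. 1. (Exact constraint satisfaction) $\bigcup_{x\in\mathbb{R}^n}\operatorname{supp}\hat F(x)\subseteq K$. 2. (Probably approximate optimality) There is a non-empty compact set $\mathcal{X}_\epsilon\subseteq\mathbb{R}^n$ such that $1-\mathbb{P}(\mathcal{X}_\epsilon)\leq\epsilon$ and, for every $x\in\mathcal{X}_\epsilon$, $$\mathcal{W}_1\Big(\hat F(x),\ \operatorname*{argmin}_{y\in C_x\cap K}L(x,y)\Big)\leq\epsilon .$$ Here $\mathcal{W}_1(\mu,\nu)=\inf_\pi\int\|u-v\|\,d\pi(u,v)$, where $\pi$ ranges over the couplings of $\mu$ and $\nu$ and $\|\cdot\|$ is the Euclidean norm, and $\mathcal{W}_1(\mu,B)=\inf_{b\in B}\mathcal{W}_1(\mu,\delta_b)$ for $B\subseteq\mathbb{R}^m$. A feedforward network with activation function $\sigma$ is a map $x\mapsto A^{(J)}x^{(J)}$ with $J\geq 1$, $x^{(0)}=x$ and $x^{(j+1)}=\sigma\big(A^{(j)}x^{(j)}+b^{(j)}\big)$ for $0\leq j<J$, where $\sigma$ acts coordinatewise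 and the $A^{(j)}$ and $b^{(j)}$ are real matrices and vectors of compatible sizes. Its width is the largest of the dimensions of $x^{(0)},\dots,x^{(J)}$ and of the output. -/

import Mathlib

open MeasureTheory Set

noncomputable section

namespace DeepMax

/-! ### Activation functions and feedforward networks -/

/-- The condition on the activation function: `σ` is continuous, and it is differentiable with
non-zero derivative at some point. -/
def KidgerLyons (σ : ℝ → ℝ) : Prop :=
  Continuous σ ∧ ∃ x₀ : ℝ, DifferentiableAt ℝ σ x₀ ∧ deriv σ x₀ ≠ 0

/-- The parameters of a non-empty stack of hidden layers, with input dimension `n` and with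
`k` neurons in the last hidden layer. -/
inductive HiddenLayers (n : ℕ) : ℕ → Type
  | first {k : ℕ} (A : Matrix (Fin k) (Fin n) ℝ) (b : Fin k → ℝ) : HiddenLayers n k
  | next {k l : ℕ} (H : HiddenLayers n k) (A : Matrix (Fin l) (Fin k) ℝ) (b : Fin l → ℝ) :
      HiddenLayers n l

namespace HiddenLayers

/-- The values of the neurons of the last hidden layer: one starts with `x` and iterates
`x ↦ σ (A x + b)`, where `σ` acts on each coordinate. -/
def eval (σ : ℝ → ℝ) {n : ℕ} : {k : ℕ} → HiddenLayers n k → (Fin n → ℝ) → (Fin k → ℝ)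
  | _, first A b, x => fun i => σ (A.mulVec x i + b i)
  | _, next H A b, x => fun i => σ (A.mulVec (H.eval σ x) i + b i)

/-- The largest dimension among the input and the hidden layers. -/
def width {n : ℕ} : {k : ℕ} → HiddenLayers n k → ℕ
  | k, first _ _ => max n k
  | l, next H _ _ => max H.width l

end HiddenLayers

/-- A feedforward network with input dimension `n` and output dimension `N`: hidden layers
followed by a linear output layer. -/
structure FeedforwardNetwork (n N : ℕ) where
  /-- The number of neurons in the last hidden layer. -/
  lastDim : ℕ
  /-- The hidden layers. -/
  hidden : HiddenLayers n lastDim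
  /-- The matrix of the output layer. -/
  outMatrix : Matrix (Fin N) (Fin lastDim) ℝ

namespace FeedforwardNetwork

/-- The function `ℝⁿ → ℝᴺ` that the network computes with activation function `σ`. -/
def eval (σ : ℝ → ℝ) {n N : ℕ} (f : FeedforwardNetwork n N) (x : EuclideanSpace ℝ (Fin n)) :
    Fin N → ℝ :=
  f.outMatrix.mulVec (f.hidden.eval σ (fun i => x i))

/-- The width: the largest dimension among the input, the hidden layers and the output. -/
def width {n N : ℕ} (f : FeedforwardNetwork n N) : ℕ :=
  max f.hidden.width N

end FeedforwardNetwork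

/-! ### Probabilistic attention -/

/-- The softmax function on `ℝᴺ`. -/
def softmax {N : ℕ} (w : Fin N → ℝ) (i : Fin N) : ℝ :=
  Real.exp (w i) / ∑ j, Real.exp (w j)

/-- Probabilistic attention: the measure on `ℝᵐ` that charges the `i`-th row of the matrix `Y`
with the `i`-th softmax weight. -/
def pAttention {N m : ℕ} (w : Fin N → ℝ) (Y : Matrix (Fin N) (Fin m) ℝ) :
    Measure (EuclideanSpace ℝ (Fin m)) :=
  ∑ i, ENNReal.ofReal (softmax w i) • Measure.dirac (WithLp.toLp 2 (Y i))

/-! ### Wasserstein distance -/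

/-- The Borel probability measures on `ℝᵐ` with a finite mean. -/
def finiteMeanMeasures (m : ℕ) : Set (Measure (EuclideanSpace ℝ (Fin m))) :=
  {μ | IsProbabilityMeasure μ ∧ Integrable (fun y => ‖y‖) μ}

/-- The couplings of `μ` and `ν`: the measures on the product with marginals `μ` and `ν`. -/
def couplings {m : ℕ} (μ ν : Measure (EuclideanSpace ℝ (Fin m))) :
    Set (Measure (EuclideanSpace ℝ (Fin m) × EuclideanSpace ℝ (Fin m))) :=
  {π | π.map Prod.fst = μ ∧ π.map Prod.snd = ν}

/-- The Wasserstein-1 distance, for the Euclidean norm, as an infimum over couplings. -/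
def W1 {m : ℕ} (μ ν : Measure (EuclideanSpace ℝ (Fin m))) : ENNReal :=
  ⨅ π ∈ couplings μ ν, ∫⁻ p, edist p.1 p.2 ∂π

/-- The Wasserstein-1 distance from `μ` to the point masses at the elements of `B`. -/
def W1ToSet {m : ℕ} (μ : Measure (EuclideanSpace ℝ (Fin m)))
    (B : Set (EuclideanSpace ℝ (Fin m))) : ENNReal :=
  ⨅ b ∈ B, W1 μ (Measure.dirac b)

/-! ### Correspondences and minimizers -/

/-- Weak measurability of a set-valued map `C`, with respect to the subspace topology of `K`:
for every relatively open `U ∩ K`, the set of `x` such that `C x` meets `U ∩ K` is Borel. -/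
def WeaklyMeasurable {n m : ℕ} (K : Set (EuclideanSpace ℝ (Fin m)))
    (C : EuclideanSpace ℝ (Fin n) → Set (EuclideanSpace ℝ (Fin m))) : Prop :=
  ∀ U : Set (EuclideanSpace ℝ (Fin m)), IsOpen U → MeasurableSet {x | (C x ∩ (U ∩ K)).Nonempty}

/-- The set of minimizers of `g` over `A`. -/
def argmin {α : Type*} (A : Set α) (g : α → ℝ) : Set α :=
  {y | y ∈ A ∧ ∀ z ∈ A, g y ≤ g z}

end DeepMax

end

/-! The minimizers depend on `x` only measurably, so continuity is recovered after discarding a set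
of small measure. Cover `K` by finitely many `r`-balls and let `g x` be the first centre within `r`
of a minimizer. This is a finite-valued measurable map (`exists_approx_argmin`), so by Lusin it is
constant at some scale `δ` on a compact `X` of large measure.

Cover `X` by `δ/2`-balls with centres `c i ∈ X` and take `Y i = g (c i)`. These rows lie in `K`,
hence so does the support. The softmax of `-β * dist x (c i) ^ 2` concentrates on centres within `δ`
of `x`, where `g (c i) = g x`. The quadratic term in `x` is common to all `i` and cancels in the
softmax, so the logits may be affine. One hidden layer of `n + 1` neurons approximates an affine
map, because `σ` is nearly affine around a point with non-zero derivative. -/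

namespace DeepMax

open Metric

/-! ### Measurability of the set of minimizers -/

section Correspondences

variable {n m : ℕ} {K : Set (EuclideanSpace ℝ (Fin m))}
  {C : EuclideanSpace ℝ (Fin n) → Set (EuclideanSpace ℝ (Fin m))}

/-- An open set in the product is a countable union of basic boxes, and weak measurability handles
each box. -/
theorem WeaklyMeasurable.measurableSet_exists_mem_isOpen (hC : WeaklyMeasurable K C)
    {U : Set (EuclideanSpace ℝ (Fin n) × EuclideanSpace ℝ (Fin m))} (hU : IsOpen U) :
    MeasurableSet {x | ∃ y ∈ C x ∩ K, (x, y) ∈ U} := by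
  let A := TopologicalSpace.countableBasis (EuclideanSpace ℝ (Fin n))
  let B := TopologicalSpace.countableBasis (EuclideanSpace ℝ (Fin m))
  have hA := TopologicalSpace.isBasis_countableBasis (EuclideanSpace ℝ (Fin n))
  have hB := TopologicalSpace.isBasis_countableBasis (EuclideanSpace ℝ (Fin m))
  have heq : {x | ∃ y ∈ C x ∩ K, (x, y) ∈ U} =
      ⋃ p ∈ {p : Set _ × Set _ | p ∈ A ×ˢ B ∧ p.1 ×ˢ p.2 ⊆ U},
        p.1 ∩ {x | (C x ∩ (p.2 ∩ K)).Nonempty} := by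
    ext x
    simp only [mem_ofPred_eq, mem_iUnion, mem_inter_iff]
    constructor
    · rintro ⟨y, ⟨hyC, hyK⟩, hyU⟩
      obtain ⟨V, W, hV, hW, hxV, hyW, hVW⟩ := isOpen_prod_iff.1 hU x y hyU
      obtain ⟨V', hV', hxV', hVV'⟩ := hA.exists_subset_of_mem_open hxV hV
      obtain ⟨W', hW', hyW', hWW'⟩ := hB.exists_subset_of_mem_open hyW hW
      exact ⟨(V', W'), ⟨⟨hV', hW'⟩, (prod_mono hVV' hWW').trans hVW⟩, hxV', y, hyC, hyW', hyK⟩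
    · rintro ⟨p, ⟨-, hp⟩, hx, y, hyC, hyp, hyK⟩
      exact ⟨y, ⟨hyC, hyK⟩, hp ⟨hx, hyp⟩⟩
  rw [heq]
  have hcount : ({p : Set _ × Set _ | p ∈ A ×ˢ B ∧ p.1 ×ˢ p.2 ⊆ U}).Countable :=
    ((TopologicalSpace.countable_countableBasis _).prod
      (TopologicalSpace.countable_countableBasis _)).mono fun p hp => hp.1
  refine MeasurableSet.biUnion hcount fun p hp => ?_
  exact (hA.isOpen hp.1.1).measurableSet.inter (hC p.2 (hB.isOpen hp.1.2))

/-- `G` is the intersection of its open `1/(j+1)`-neighbourhoods. Compactness of `C x ∩ K` gives a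
point closest to `G`, so one `y` serves all `j`. -/
theorem WeaklyMeasurable.measurableSet_exists_mem_isClosed (hC : WeaklyMeasurable K C)
    (hcomp : ∀ x, IsCompact (C x ∩ K))
    {G : Set (EuclideanSpace ℝ (Fin n) × EuclideanSpace ℝ (Fin m))} (hG : IsClosed G) :
    MeasurableSet {x | ∃ y ∈ C x ∩ K, (x, y) ∈ G} := by
  have heq : {x | ∃ y ∈ C x ∩ K, (x, y) ∈ G} =
      ⋂ j : ℕ, {x | ∃ y ∈ C x ∩ K, (x, y) ∈ {p | infEDist p G < ((j : ENNReal) + 1)⁻¹}} := by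
    ext x
    simp only [mem_ofPred_eq, mem_iInter]
    constructor
    · rintro ⟨y, hy, hyG⟩ j
      refine ⟨y, hy, ?_⟩
      rw [infEDist_zero_of_mem hyG]
      simp
    · intro h
      obtain ⟨y₀, hy₀, -⟩ := h 0
      obtain ⟨y, hy, hmin⟩ := (hcomp x).exists_isMinOn ⟨y₀, hy₀⟩
        (f := fun y => infEDist (x, y) G) (continuous_infEDist.comp (by fun_prop)).continuousOn
      refine ⟨y, hy, (mem_iff_infEDist_zero_of_closed hG).2 ?_⟩
      by_contra hne
      obtain ⟨j, hj⟩ := ENNReal.exists_inv_nat_lt hne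
      obtain ⟨z, hz, hzj⟩ := h j
      have h1 : infEDist (x, y) G ≤ infEDist (x, z) G := hmin hz
      have h2 : ((j : ENNReal) + 1)⁻¹ ≤ (j : ENNReal)⁻¹ := ENNReal.inv_le_inv.2 le_self_add
      exact absurd (h1.trans_lt (hzj.trans_le (h2.trans hj.le))) (lt_irrefl _)
  rw [heq]
  refine MeasurableSet.iInter fun j => hC.measurableSet_exists_mem_isOpen ?_
  exact isOpen_lt continuous_infEDist continuous_const

/-- A minimizer lies in `F` iff every rational level reached on `C x ∩ K` is also reached on `C x ∩
K ∩ F`. This is a countable condition on closed sublevel sets. -/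
theorem WeaklyMeasurable.measurableSet_argmin_inter_nonempty (hC : WeaklyMeasurable K C)
    (hcomp : ∀ x, IsCompact (C x ∩ K)) (hne : ∀ x, (C x ∩ K).Nonempty)
    {L : EuclideanSpace ℝ (Fin n) → EuclideanSpace ℝ (Fin m) → ℝ}
    (hL : Continuous fun p : EuclideanSpace ℝ (Fin n) × EuclideanSpace ℝ (Fin m) => L p.1 p.2)
    {F : Set (EuclideanSpace ℝ (Fin m))} (hF : IsClosed F) :
    MeasurableSet {x | (argmin (C x ∩ K) (L x) ∩ F).Nonempty} := by
  have heq : {x | (argmin (C x ∩ K) (L x) ∩ F).Nonempty} =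
      ⋂ q : ℚ, ({x | ∃ y ∈ C x ∩ K, (x, y) ∈ {p | L p.1 p.2 ≤ q}}ᶜ ∪
        {x | ∃ y ∈ C x ∩ K, (x, y) ∈ {p | L p.1 p.2 ≤ q} ∩ {p | p.2 ∈ F}}) := by
    ext x
    simp only [mem_ofPred_eq, mem_iInter, mem_union, mem_compl_iff, mem_inter_iff]
    constructor
    · rintro ⟨y, ⟨hy, hmin⟩, hyF⟩ q
      refine or_iff_not_imp_left.2 fun h => ?_
      obtain ⟨z, hz, hzq⟩ := not_not.1 h
      exact ⟨y, hy, (hmin z hz).trans hzq, hyF⟩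
    · intro h
      have hLx : Continuous (L x) := hL.comp (by fun_prop : Continuous fun y => (x, y))
      obtain ⟨z, hz, hzmin⟩ := (hcomp x).exists_isMinOn (hne x) hLx.continuousOn
      have key : ∀ q : ℚ, L x z ≤ q → ∃ y ∈ C x ∩ K, L x y ≤ q ∧ y ∈ F := fun q hq =>
        (h q).resolve_left (not_not.2 ⟨z, hz, hq⟩)
      obtain ⟨q₀, hq₀⟩ := exists_rat_gt (L x z)
      obtain ⟨y₀, hy₀, -, hy₀F⟩ := key q₀ hq₀.le
      obtain ⟨y, ⟨hy, hyF⟩, hymin⟩ := ((hcomp x).inter_right hF).exists_isMinOn ⟨y₀, hy₀, hy₀F⟩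
        hLx.continuousOn
      refine ⟨y, ⟨hy, fun w hw => ?_⟩, hyF⟩
      refine le_trans ?_ (hzmin hw)
      refine le_of_forall_gt_imp_ge_of_dense fun a ha => ?_
      obtain ⟨q, hq, hqa⟩ := exists_rat_btwn ha
      obtain ⟨y', hy', hy'q, hy'F⟩ := key q hq.le
      exact (hymin ⟨hy', hy'F⟩ : L x y ≤ L x y').trans (hy'q.trans hqa.le)
  rw [heq]
  have hcl : ∀ q : ℚ, IsClosed {p : EuclideanSpace ℝ (Fin n) × EuclideanSpace ℝ (Fin m) |
      L p.1 p.2 ≤ q} := fun q => isClosed_le hL continuous_const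
  exact MeasurableSet.iInter fun q =>
    (hC.measurableSet_exists_mem_isClosed hcomp (hcl q)).compl.union
      (hC.measurableSet_exists_mem_isClosed hcomp ((hcl q).inter (hF.preimage continuous_snd)))

end Correspondences

/-- **Lusin's theorem** for a finite-valued measurable function. -/
theorem exists_isCompact_eq_of_dist_lt {E ι : Type*} [PseudoMetricSpace E] [MeasurableSpace E]
    [BorelSpace E] [T2Space E] (P : Measure E) [IsFiniteMeasure P]
    [P.InnerRegularCompactLTTop] [Fintype ι] (k : E → ι)
    (hk : ∀ i, MeasurableSet (k ⁻¹' {i})) {η : ENNReal} (hη : η ≠ 0) :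
    ∃ X : Set E, IsCompact X ∧ P Xᶜ ≤ η ∧
      ∃ δ > 0, ∀ x ∈ X, ∀ x' ∈ X, dist x x' < δ → k x = k x' := by
  classical
  have hη' : η / (Fintype.card ι + 1) ≠ 0 := by
    simp [ENNReal.div_eq_zero_iff, hη]
  choose Z hZsub hZ hZP using fun i => (hk i).exists_isCompact_sdiff_lt (measure_ne_top P _) hη'
  refine ⟨⋃ i, Z i, isCompact_iUnion hZ, ?_, ?_⟩
  · have hsub : (⋃ i, Z i)ᶜ ⊆ ⋃ i, k ⁻¹' {i} \ Z i := fun x hx =>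
      mem_iUnion.2 ⟨k x, rfl, fun h => hx (mem_iUnion.2 ⟨_, h⟩)⟩
    calc P (⋃ i, Z i)ᶜ ≤ ∑ i, P (k ⁻¹' {i} \ Z i) :=
          (measure_mono hsub).trans (measure_iUnion_fintype_le _ _)
      _ ≤ ∑ _i : ι, η / (Fintype.card ι + 1) := Finset.sum_le_sum fun i _ => (hZP i).le
      _ ≤ (Fintype.card ι + 1) * (η / (Fintype.card ι + 1)) := by
          rw [Finset.sum_const, nsmul_eq_mul, Finset.card_univ]
          gcongr
          exact le_self_add
      _ ≤ η := ENNReal.mul_div_le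
  -- With the discrete uniformity on `ι`, uniform continuity on the compact union of the pieces
  -- yields a single scale `δ` of constancy.
  · let _ : UniformSpace ι := ⊥
    have : DiscreteUniformity ι := ⟨rfl⟩
    have hcont : ContinuousOn k (⋃ i, Z i) := by
      intro x hx
      have hcl : IsClosed (⋃ i ∈ {i | i ≠ k x}, Z i) :=
        (toFinite _).isClosed_biUnion fun i _ => (hZ i).isClosed
      have hxm : x ∉ ⋃ i ∈ {i | i ≠ k x}, Z i := by
        simp only [mem_iUnion, not_exists]
        intro i hi hxi
        exact hi (hZsub i hxi).symm
      refine tendsto_nhds_of_eventually_eq ?_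
      filter_upwards [self_mem_nhdsWithin,
        mem_nhdsWithin_of_mem_nhds (hcl.isOpen_compl.mem_nhds hxm)] with z hz hz'
      obtain ⟨i, hi⟩ := mem_iUnion.1 hz
      have hik : k z = i := hZsub i hi
      by_contra hne
      exact hz' (mem_biUnion (show i ≠ k x from hik ▸ hne) hi)
    have hu := (isCompact_iUnion hZ).uniformContinuousOn_of_continuous hcont
    have hmem : {p : ι × ι | p.1 = p.2} ∈ uniformity ι := by
      rw [DiscreteUniformity.eq_principal_setRelId]
      exact fun p hp => hp
    have := hu hmem
    rw [Filter.mem_map, Filter.mem_inf_principal, Metric.mem_uniformity_dist] at this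
    obtain ⟨δ, hδ, h⟩ := this
    exact ⟨δ, hδ, fun x hx x' hx' hd => h hd ⟨hx, hx'⟩⟩

/-- A network with one hidden layer of `n + 1` neurons approximates an affine map uniformly on
bounded sets. -/
theorem KidgerLyons.exists_network_near_affine {σ : ℝ → ℝ} (hσ : KidgerLyons σ) {n N : ℕ}
    (a : Fin N → Fin n → ℝ) (b : Fin N → ℝ) (R : ℝ) {η : ℝ} (hη : 0 < η) :
    ∃ f : FeedforwardNetwork n N, f.width ≤ 2 + n + N ∧
      ∀ x : EuclideanSpace ℝ (Fin n), ‖x‖ ≤ R → ∀ i,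
        |f.eval σ x i - (∑ k, a i k * x k + b i)| ≤ η := by
  obtain ⟨-, x₀, hdiff, hd⟩ := hσ
  set d := deriv σ x₀ with hddef
  obtain ⟨c₀, hc₀⟩ : ∃ c₀, σ c₀ ≠ 0 := by
    by_contra! h
    have : σ = fun _ => 0 := funext h
    rw [hddef, this] at hd
    simp at hd
  wlog hR : 0 < R generalizing R
  · obtain ⟨f, hf, h⟩ := this 1 one_pos
    exact ⟨f, hf, fun x hx => h x (hx.trans (by linarith))⟩
  set S : ℝ := 1 + ∑ i, ∑ k, |a i k| with hS
  have hS0 : 0 < S := by positivity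
  have hd0 : 0 < |d| := abs_pos.2 hd
  have hc : 0 < η * |d| / (R * S) := by positivity
  have hlo := (hasDerivAt_iff_isLittleO_nhds_zero.1 hdiff.hasDerivAt).bound hc
  obtain ⟨t₀, ht₀, hlo⟩ := Metric.eventually_nhds_iff.1 hlo
  -- For `|t| ≤ R` this keeps `h * t` inside the radius `t₀` where the first-order expansion holds.
  set h := t₀ / (2 * R) with hh
  have hh0 : 0 < h := by positivity
  have happrox : ∀ t : ℝ, |t| ≤ R → |(σ (x₀ + h * t) - σ x₀) / (h * d) - t| ≤ η / S := by
    intro t ht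
    have hht : |h * t| < t₀ := by
      rw [abs_mul, abs_of_pos hh0]
      calc h * |t| ≤ h * R := by gcongr
        _ = t₀ / 2 := by rw [hh]; field_simp
        _ < t₀ := by linarith
    have h1 := hlo (y := h * t) (by simpa using hht)
    rw [Real.norm_eq_abs, Real.norm_eq_abs, smul_eq_mul] at h1
    have h2 : (σ (x₀ + h * t) - σ x₀) / (h * d) - t =
        (σ (x₀ + h * t) - σ x₀ - h * t * d) / (h * d) := by
      field_simp
    rw [h2, abs_div, abs_mul h d, abs_of_pos hh0, div_le_iff₀ (by positivity)]
    refine h1.trans ?_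
    rw [abs_mul, abs_of_pos hh0]
    calc η * |d| / (R * S) * (h * |t|) ≤ η * |d| / (R * S) * (h * R) := by gcongr
      _ = η / S * (h * |d|) := by field_simp
  -- Neuron `k` computes `σ (x₀ + h * x k)`. The last one is the non-zero constant `σ c₀`, from
  -- which the bias-free output layer builds `b` and the correction for `σ x₀`.
  let A : Matrix (Fin (n + 1)) (Fin n) ℝ :=
    fun j => Fin.lastCases (motive := fun _ => Fin n → ℝ) (fun _ => 0) (fun k => Pi.single k h) j
  let β : Fin (n + 1) → ℝ := fun j =>
    Fin.lastCases (motive := fun _ => ℝ) c₀ (fun _ => x₀) j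
  let O : Matrix (Fin N) (Fin (n + 1)) ℝ := fun i j =>
    Fin.lastCases (motive := fun _ => ℝ) ((b i - ∑ k, a i k * (σ x₀ / (h * d))) / σ c₀)
      (fun k => a i k / (h * d)) j
  refine ⟨⟨n + 1, .first A β, O⟩, ?_, fun x hx i => ?_⟩
  · simp only [FeedforwardNetwork.width, HiddenLayers.width]
    omega
  · have heval : FeedforwardNetwork.eval σ ⟨n + 1, .first A β, O⟩ x i =
        ∑ k, a i k * ((σ (x₀ + h * x k) - σ x₀) / (h * d)) + b i := by
      simp only [FeedforwardNetwork.eval, HiddenLayers.eval, Matrix.mulVec, dotProduct,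
        Fin.sum_univ_castSucc, A, β, O, Fin.lastCases_last, Fin.lastCases_castSucc, zero_mul,
        Finset.sum_const_zero, zero_add, Pi.single_apply, ite_mul, Finset.sum_ite_eq',
        Finset.mem_univ, if_true]
      rw [div_mul_cancel₀ _ hc₀, add_sub, add_sub_right_comm, ← Finset.sum_sub_distrib]
      congr 1
      refine Finset.sum_congr rfl fun k _ => ?_
      rw [add_comm (h * x k)]
      ring
    rw [heval, add_sub_add_right_eq_sub, ← Finset.sum_sub_distrib]
    calc |∑ k, (a i k * ((σ (x₀ + h * x k) - σ x₀) / (h * d)) - a i k * x k)|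
        ≤ ∑ k, |a i k| * (η / S) := by
          refine (Finset.abs_sum_le_sum_abs _ _).trans (Finset.sum_le_sum fun k _ => ?_)
          rw [← mul_sub, abs_mul]
          gcongr
          exact happrox _ ((PiLp.norm_apply_le x k).trans hx)
      _ = (∑ k, |a i k|) * (η / S) := by rw [Finset.sum_mul]
      _ ≤ S * (η / S) := by
          gcongr
          have := Finset.single_le_sum (f := fun i => ∑ k, |a i k|)
            (fun i _ => Finset.sum_nonneg fun k _ => abs_nonneg (a i k)) (Finset.mem_univ i)
          linarith
      _ = η := by field_simp

/-! ### Softmax weights -/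

section Softmax

variable {N : ℕ} (w : Fin N → ℝ)

theorem softmax_nonneg (i : Fin N) : 0 ≤ softmax w i := by
  unfold softmax
  positivity

theorem sum_softmax [NeZero N] : ∑ i, softmax w i = 1 := by
  have : 0 < ∑ j, Real.exp (w j) :=
    Finset.sum_pos (fun _ _ => Real.exp_pos _) Finset.univ_nonempty
  simp only [softmax, ← Finset.sum_div]
  exact div_self this.ne'

/-- The denominator is at least its `j`-th term, so one much larger logit makes the `i`-th weight
small. -/
theorem softmax_le_exp_sub (i j : Fin N) : softmax w i ≤ Real.exp (w i - w j) := by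
  rw [softmax, Real.exp_sub]
  gcongr
  exact Finset.single_le_sum (f := fun j => Real.exp (w j)) (fun _ _ => (Real.exp_pos _).le)
    (Finset.mem_univ j)

end Softmax

/-! ### Attention measures and their transport cost to a point mass -/

section Attention

variable {N m : ℕ} (w : Fin N → ℝ) (Y : Matrix (Fin N) (Fin m) ℝ)

theorem lintegral_pAttention {g : EuclideanSpace ℝ (Fin m) → ENNReal} (hg : Measurable g) :
    ∫⁻ y, g y ∂(pAttention w Y) =
      ∑ i, ENNReal.ofReal (softmax w i) * g (WithLp.toLp 2 (Y i)) := by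
  simp only [pAttention, lintegral_finsetSum_measure, lintegral_smul_measure,
    lintegral_dirac' _ hg, smul_eq_mul]

theorem isProbabilityMeasure_pAttention [NeZero N] : IsProbabilityMeasure (pAttention w Y) := by
  refine ⟨?_⟩
  rw [← lintegral_one, lintegral_pAttention w Y measurable_const]
  simp only [mul_one]
  rw [← ENNReal.ofReal_sum_of_nonneg fun i _ => softmax_nonneg w i, sum_softmax,
    ENNReal.ofReal_one]

theorem pAttention_mem_finiteMeanMeasures [NeZero N] : pAttention w Y ∈ finiteMeanMeasures m := by
  refine ⟨isProbabilityMeasure_pAttention w Y, ?_⟩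
  refine integrable_finsetSum_measure.2 fun i _ => ?_
  exact (integrable_dirac (by simp)).smul_measure ENNReal.ofReal_ne_top

theorem support_pAttention_subset {K : Set (EuclideanSpace ℝ (Fin m))} (hK : IsClosed K)
    (hY : ∀ i, WithLp.toLp 2 (Y i) ∈ K) : (pAttention w Y).support ⊆ K := by
  refine Measure.support_subset_of_isClosed hK ?_
  rw [mem_ae_iff, ← lintegral_indicator_one hK.measurableSet.compl,
    lintegral_pAttention w Y (measurable_one.indicator hK.measurableSet.compl)]
  simp [hY]

/-- The image of `μ` under `y ↦ (y, b)` is a coupling with this cost. -/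
theorem W1_dirac_le {m : ℕ} (μ : Measure (EuclideanSpace ℝ (Fin m))) [IsProbabilityMeasure μ]
    (b : EuclideanSpace ℝ (Fin m)) :
    W1 μ (Measure.dirac b) ≤ ∫⁻ y, edist y b ∂μ := by
  have hmeas : Measurable fun y : EuclideanSpace ℝ (Fin m) => (y, b) := by fun_prop
  have hπ : (μ.map fun y => (y, b)) ∈ couplings μ (Measure.dirac b) := by
    refine ⟨?_, ?_⟩
    · rw [Measure.map_map measurable_fst hmeas]
      exact Measure.map_id
    · rw [Measure.map_map measurable_snd hmeas]
      change μ.map (fun _ => b) = _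
      rw [Measure.map_const, measure_univ, one_smul]
  exact (iInf₂_le _ hπ).trans_eq (lintegral_map (by fun_prop) hmeas)

theorem W1_pAttention_dirac_le [NeZero N] (b : EuclideanSpace ℝ (Fin m)) :
    W1 (pAttention w Y) (Measure.dirac b) ≤
      ENNReal.ofReal (∑ i, softmax w i * dist (WithLp.toLp 2 (Y i)) b) := by
  have := isProbabilityMeasure_pAttention w Y
  refine (W1_dirac_le _ b).trans_eq ?_
  rw [lintegral_pAttention w Y (by fun_prop), ENNReal.ofReal_sum_of_nonneg fun i _ =>
    mul_nonneg (softmax_nonneg w i) dist_nonneg]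
  simp only [edist_dist, ENNReal.ofReal_mul (softmax_nonneg w _)]

end Attention

/-- The softmax of an affine map concentrates on the centers `c i` close to `x`. -/
theorem KidgerLyons.exists_network_softmax_le {σ : ℝ → ℝ} (hσ : KidgerLyons σ) {n N : ℕ}
    (c : Fin N → EuclideanSpace ℝ (Fin n)) {X : Set (EuclideanSpace ℝ (Fin n))}
    (hX : Bornology.IsBounded X) {δ : ℝ} (hδ : 0 < δ)
    (hcover : ∀ x ∈ X, ∃ j, dist x (c j) < δ / 2) {κ : ℝ} (hκ : 0 < κ) :
    ∃ f : FeedforwardNetwork n N, f.width ≤ 2 + n + N ∧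
      ∀ x ∈ X, ∀ i, δ ≤ dist x (c i) → softmax (f.eval σ x) i ≤ κ := by
  obtain ⟨R, hR⟩ := hX.exists_norm_le
  -- The squared distances differ by at least `δ ^ 2 - (δ / 2) ^ 2`. The resulting gap `2 + κ⁻¹`
  -- absorbs a network error of `1` in each of two logits and leaves `exp (-κ⁻¹) ≤ κ`.
  set β : ℝ := (2 + κ⁻¹) / (3 / 4 * δ ^ 2) with hβ
  have hβ0 : 0 < β := by positivity
  obtain ⟨f, hfw, hf⟩ := hσ.exists_network_near_affine (fun i k => 2 * β * c i k)
    (fun i => -β * ‖c i‖ ^ 2) R one_pos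
  refine ⟨f, hfw, fun x hx i hi => ?_⟩
  obtain ⟨j, hj⟩ := hcover x hx
  have haff : ∀ i, ∑ k, 2 * β * c i k * x k + -β * ‖c i‖ ^ 2 =
      β * ‖x‖ ^ 2 - β * dist x (c i) ^ 2 := by
    intro i
    have hin : ∑ k, 2 * β * c i k * x k = 2 * β * inner ℝ x (c i) := by
      rw [PiLp.inner_apply, Finset.mul_sum]
      refine Finset.sum_congr rfl fun k _ => ?_
      simp only [RCLike.inner_apply, conj_trivial]
      ring
    rw [hin, dist_eq_norm, norm_sub_sq_real]
    ring
  have h1 := abs_le.1 (hf x (hR x hx) i)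
  have h2 := abs_le.1 (hf x (hR x hx) j)
  rw [haff] at h1 h2
  have hsq1 : δ ^ 2 ≤ dist x (c i) ^ 2 := by gcongr
  have hsq2 : dist x (c j) ^ 2 ≤ (δ / 2) ^ 2 := by gcongr
  have hβδ : β * (3 / 4 * δ ^ 2) = 2 + κ⁻¹ := by rw [hβ]; field_simp
  have hgap : β * dist x (c j) ^ 2 - β * dist x (c i) ^ 2 ≤ -(2 + κ⁻¹) := by
    rw [← hβδ, ← mul_sub, ← mul_neg]
    gcongr
    linarith
  calc softmax (f.eval σ x) i ≤ Real.exp (f.eval σ x i - f.eval σ x j) :=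
        softmax_le_exp_sub _ i j
    _ ≤ Real.exp (-κ⁻¹) := Real.exp_le_exp.2 (by linarith [h1.2, h2.1])
    _ ≤ κ := by
      rw [Real.exp_neg]
      refine inv_le_of_inv_le₀ hκ ?_
      linarith [Real.add_one_le_exp κ⁻¹]

/-- A locally constant function on a compact set is approximated by the attention of a network
whose values are values of the function. -/
theorem KidgerLyons.exists_network_sum_softmax_mul_dist_le {σ : ℝ → ℝ} (hσ : KidgerLyons σ)
    {n m : ℕ} {X : Set (EuclideanSpace ℝ (Fin n))} (hX : IsCompact X) (hXne : X.Nonempty)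
    {K : Set (EuclideanSpace ℝ (Fin m))} (hK : Bornology.IsBounded K)
    {g : EuclideanSpace ℝ (Fin n) → EuclideanSpace ℝ (Fin m)} (hg : ∀ x ∈ X, g x ∈ K)
    {δ : ℝ} (hδ : 0 < δ) (hgδ : ∀ x ∈ X, ∀ x' ∈ X, dist x x' < δ → g x = g x')
    {r : ℝ} (hr : 0 < r) :
    ∃ (N : ℕ) (f : FeedforwardNetwork n N) (Y : Matrix (Fin N) (Fin m) ℝ),
      0 < N ∧ f.width ≤ 2 + n + N ∧ (∀ i, WithLp.toLp 2 (Y i) ∈ K) ∧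
      ∀ x ∈ X, ∀ b ∈ K, dist b (g x) ≤ r →
        ∑ i, softmax (f.eval σ x) i * dist (WithLp.toLp 2 (Y i)) b ≤ 2 * r := by
  obtain ⟨t, htX, htfin, ht⟩ := finite_cover_balls_of_compact hX (half_pos hδ)
  obtain ⟨N, c, -, hc⟩ := htfin.fin_param
  have hcX : ∀ i, c i ∈ X := fun i => htX (hc ▸ mem_range_self i)
  have hcover : ∀ x ∈ X, ∃ j, dist x (c j) < δ / 2 := by
    intro x hx
    obtain ⟨y, hy, hxy⟩ := mem_iUnion₂.1 (ht hx)
    obtain ⟨j, rfl⟩ := hc ▸ hy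
    exact ⟨j, hxy⟩
  have hN : 0 < N := by
    obtain ⟨x, hx⟩ := hXne
    obtain ⟨j, -⟩ := hcover x hx
    exact j.pos
  have : NeZero N := ⟨hN.ne'⟩
  obtain ⟨D, hD⟩ := Metric.isBounded_iff.1 hK
  have hD0 : 0 ≤ D := by simpa using hD (hg _ (hcX 0)) (hg _ (hcX 0))
  -- With this `κ` the at most `N` far centres, each at cost at most `D`, contribute at most `r` in
  -- total. The near centres contribute at most another `r`.
  obtain ⟨f, hfw, hf⟩ := hσ.exists_network_softmax_le c hX.isBounded hδ hcover
    (κ := r / (N * (D + 1))) (by positivity)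
  refine ⟨N, f, fun i => (g (c i)).ofLp, hN, hfw, fun i => hg _ (hcX i), fun x hx b hb hbx => ?_⟩
  have hterm : ∀ i, softmax (f.eval σ x) i * dist (g (c i)) b ≤
      softmax (f.eval σ x) i * r + r / N := by
    intro i
    rcases lt_or_ge (dist x (c i)) δ with hi | hi
    · rw [← hgδ x hx _ (hcX i) hi, dist_comm]
      have := mul_le_mul_of_nonneg_left hbx (softmax_nonneg (f.eval σ x) i)
      have : 0 ≤ r / N := by positivity
      linarith
    · have h1 := hf x hx i hi
      have h2 : softmax (f.eval σ x) i * dist (g (c i)) b ≤ r / (N * (D + 1)) * (D + 1) := by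
        gcongr
        exact (hD (hg _ (hcX i)) hb).trans (by linarith)
      have h3 : r / (N * (D + 1)) * (D + 1) = r / N := by field_simp
      have := mul_nonneg (softmax_nonneg (f.eval σ x) i) hr.le
      linarith
  calc ∑ i, softmax (f.eval σ x) i * dist (g (c i)) b
      ≤ ∑ i, (softmax (f.eval σ x) i * r + r / N) := Finset.sum_le_sum fun i _ => hterm i
    _ = 2 * r := by
      rw [Finset.sum_add_distrib, ← Finset.sum_mul, sum_softmax, Finset.sum_const,
        Finset.card_univ, Fintype.card_fin, nsmul_eq_mul]
      field_simp
      ring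

/-- An approximate measurable selection of the minimizers, which is locally constant on a compact
set of large measure. -/
theorem WeaklyMeasurable.exists_approx_argmin {n m : ℕ} {K : Set (EuclideanSpace ℝ (Fin m))}
    (hK : IsCompact K) {C : EuclideanSpace ℝ (Fin n) → Set (EuclideanSpace ℝ (Fin m))}
    (hC : WeaklyMeasurable K C) (hCclosed : ∀ x, IsClosed (C x)) (hCK : ∀ x, (C x ∩ K).Nonempty)
    {L : EuclideanSpace ℝ (Fin n) → EuclideanSpace ℝ (Fin m) → ℝ}
    (hL : Continuous fun p : EuclideanSpace ℝ (Fin n) × EuclideanSpace ℝ (Fin m) => L p.1 p.2)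
    (P : Measure (EuclideanSpace ℝ (Fin n))) [IsFiniteMeasure P]
    {r : ℝ} (hr : 0 < r) {η : ENNReal} (hη : η ≠ 0) :
    ∃ (g : EuclideanSpace ℝ (Fin n) → EuclideanSpace ℝ (Fin m))
      (X : Set (EuclideanSpace ℝ (Fin n))), IsCompact X ∧ P Xᶜ ≤ η ∧ (∀ x, g x ∈ K) ∧
      (∀ x, ∃ b ∈ argmin (C x ∩ K) (L x), dist b (g x) ≤ r) ∧
      ∃ δ > 0, ∀ x ∈ X, ∀ x' ∈ X, dist x x' < δ → g x = g x' := by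
  have hcomp : ∀ x, IsCompact (C x ∩ K) := fun x => hK.inter_left (hCclosed x)
  obtain ⟨t, htK, htfin, ht⟩ := finite_cover_balls_of_compact hK hr
  obtain ⟨p, c, -, hc⟩ := htfin.fin_param
  have hcK : ∀ i, c i ∈ K := fun i => htK (hc ▸ mem_range_self i)
  let A : Fin p → Set (EuclideanSpace ℝ (Fin n)) := fun i =>
    {x | (argmin (C x ∩ K) (L x) ∩ closedBall (c i) r).Nonempty}
  have hA : ∀ i, MeasurableSet (A i) := fun i =>
    hC.measurableSet_argmin_inter_nonempty hcomp hCK hL isClosed_closedBall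
  have hAcover : ∀ x, ∃ i, x ∈ A i := by
    intro x
    have hLx : Continuous (L x) := hL.comp (by fun_prop : Continuous fun y => (x, y))
    obtain ⟨z, hz, hzmin⟩ := (hcomp x).exists_isMinOn (hCK x) hLx.continuousOn
    obtain ⟨y, hy, hzy⟩ := mem_iUnion₂.1 (ht hz.2)
    obtain ⟨j, rfl⟩ := hc ▸ hy
    exact ⟨j, z, ⟨hz, fun w hw => hzmin hw⟩, ball_subset_closedBall hzy⟩
  -- Taking the least index makes each fibre of the choice a finite Boolean combination of the
  -- measurable sets `A i`.
  have hfirst : ∀ x, ∃ i, x ∈ A i ∧ ∀ j < i, x ∉ A j := fun x => by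
    obtain ⟨i, hi, hmin⟩ := WellFounded.has_min (wellFounded_lt (α := Fin p)) {i | x ∈ A i}
      (hAcover x)
    exact ⟨i, hi, fun j hj hxj => hmin j hxj hj⟩
  choose k hkA hkmin using hfirst
  have hk : ∀ i, k ⁻¹' {i} = A i ∩ ⋂ j ∈ {j | j < i}, (A j)ᶜ := by
    intro i
    ext x
    simp only [mem_preimage, mem_singleton_iff, mem_inter_iff, mem_iInter, mem_ofPred_eq,
      mem_compl_iff]
    constructor
    · rintro rfl
      exact ⟨hkA x, hkmin x⟩
    · rintro ⟨hi, hmin⟩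
      exact le_antisymm (not_lt.1 fun h => hkmin x _ h hi) (not_lt.1 fun h => hmin _ h (hkA x))
  have hkmeas : ∀ i, MeasurableSet (k ⁻¹' {i}) := fun i => by
    rw [hk]
    exact (hA i).inter (MeasurableSet.biInter (to_countable _) fun j _ => (hA j).compl)
  obtain ⟨X, hX, hXP, δ, hδ, hloc⟩ := exists_isCompact_eq_of_dist_lt P k hkmeas hη
  refine ⟨fun x => c (k x), X, hX, hXP, fun x => hcK _, fun x => ?_, δ, hδ,
    fun x hx x' hx' hd => congrArg c (hloc x hx x' hx' hd)⟩
  obtain ⟨b, hb, hbc⟩ := hkA x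
  exact ⟨b, hb, hbc⟩

end DeepMax

theorem mainTheorem2 {n m : ℕ} (σ : ℝ → ℝ) (hσ : DeepMax.KidgerLyons σ)
    (K : Set (EuclideanSpace ℝ (Fin m))) (hKne : K.Nonempty) (hK : IsCompact K)
    (C : EuclideanSpace ℝ (Fin n) → Set (EuclideanSpace ℝ (Fin m)))
    (hCmeas : DeepMax.WeaklyMeasurable K C) (hCclosed : ∀ x, IsClosed (C x))
    (hCK : ∀ x, (C x ∩ K).Nonempty)
    (L : EuclideanSpace ℝ (Fin n) → EuclideanSpace ℝ (Fin m) → ℝ)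
    (hL : Continuous (fun p : EuclideanSpace ℝ (Fin n) × EuclideanSpace ℝ (Fin m) => L p.1 p.2))
    (P : Measure (EuclideanSpace ℝ (Fin n))) [IsProbabilityMeasure P]
    (ε : ℝ) (hε0 : 0 < ε) (hε1 : ε ≤ 1) :
    ∃ (N : ℕ) (f : DeepMax.FeedforwardNetwork n N) (Y : Matrix (Fin N) (Fin m) ℝ),
      0 < N ∧ f.width ≤ 2 + n + N ∧
      (∀ x, DeepMax.pAttention (f.eval σ x) Y ∈ DeepMax.finiteMeanMeasures m) ∧
      (⋃ x, (DeepMax.pAttention (f.eval σ x) Y).support) ⊆ K ∧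
      ∃ X : Set (EuclideanSpace ℝ (Fin n)), IsCompact X ∧ X.Nonempty ∧
        (∀ x ∈ X, DeepMax.W1ToSet (DeepMax.pAttention (f.eval σ x) Y)
          (DeepMax.argmin (C x ∩ K) (L x)) ≤ ENNReal.ofReal ε) ∧
        1 - P.real X ≤ ε := by
  have hη : ENNReal.ofReal (ε / 2) ≠ 0 := by
    rw [ne_eq, ENNReal.ofReal_eq_zero, not_le]
    exact half_pos hε0
  obtain ⟨g, X, hX, hXP, hgK, hgmin, δ, hδ, hgδ⟩ :=
    hCmeas.exists_approx_argmin hK hCclosed hCK hL P (half_pos hε0) hη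
  have hPX : 1 - P.real X ≤ ε / 2 := by
    rw [← probReal_compl_eq_one_sub hX.measurableSet]
    exact ENNReal.toReal_le_of_le_ofReal (half_pos hε0).le hXP
  -- An empty `X` would force `1 ≤ ε / 2`, against `ε ≤ 1`.
  have hXne : X.Nonempty := by
    by_contra h
    rw [not_nonempty_iff_eq_empty.1 h, measureReal_empty] at hPX
    linarith
  -- The radius `ε / 2` is doubled by the attention bound, which gives exactly `ε`.
  obtain ⟨N, f, Y, hN, hfw, hYK, hf⟩ := hσ.exists_network_sum_softmax_mul_dist_le hX hXne
    hK.isBounded (fun x _ => hgK x) hδ hgδ (half_pos hε0)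
  have : NeZero N := ⟨hN.ne'⟩
  refine ⟨N, f, Y, hN, hfw, fun x => DeepMax.pAttention_mem_finiteMeanMeasures _ _,
    iUnion_subset fun x => DeepMax.support_pAttention_subset _ _ hK.isClosed hYK,
    X, hX, hXne, fun x hx => ?_, by linarith⟩
  obtain ⟨b, hb, hbx⟩ := hgmin x
  refine (iInf₂_le b hb).trans ((DeepMax.W1_pAttention_dirac_le _ _ b).trans ?_)
  refine ENNReal.ofReal_le_ofReal ((hf x hx b hb.1.2 hbx).trans_eq ?_)
  ring
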